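/- Let $U,V\subset\mathbb C$ be open discs and $n\ge 1$. Consider a linear differential equation of order $n$ in the variable $t$, with a complex parameter $\varepsilon$, $$a_n(t,\varepsilon)\,y^{(n)}+a_{n-1}(t,\varepsilon)\,y^{(n-1)}+\dots+a_0(t,\varepsilon)\,y=0 ,$$ where $a_0,\dots,a_n$ are meromorphic functions of $(t,\varepsilon)$ on the polydisc $U\times V$ and $a_n\not\equiv 0$. Call a meromorphic function $f(t,\varepsilon)$ singularly perturbed at $\varepsilon_0$ if, when it is written as a quotient $f=u/v$ of holomorphic functions (near a point $(t_0,\varepsilon_0)$ with $t_0\in U$), $v$ is divisible by a strictly higher power of $\varepsilon-\varepsilon_0$ than $u$ is; this depends neither on $t_0$ nor on the choice of $u$ and $v$. Assume that the equation is singularly perturbed at some $\varepsilon_0\in V$, that is, at least one of the normalized coefficients $a_k/a_n$ $(0\le k<n)$ is singularly perturbed at $\varepsilon_0$. Let $y_1(t,\varepsilon),\dots,y_l(t,\varepsilon)$ be solutions of the equation that are holomorphic in $(t,\varepsilon)$ on $U\times V$. Then for every fixed $\hat\varepsilon\in V$, $$\dim_{\mathbb C}\operatorname{span}_{\mathbb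 C}\bigl(y_1(\cdot,\hat\varepsilon),\dots,y_l(\cdot,\hat\varepsilon)\bigr)\le n-1 ,$$ the span being taken in the space of functions on $U$. -/

import Mathlib

open Filter Topology

namespace SingularODE

/-- The germ at `p` of the function `f` of `z = (t, ε)` is the quotient `u / v` of two germs of
holomorphic functions, `v` not being identically zero near `p`. The values of `f` on the zero set
of `v` are irrelevant. -/
def IsQuotientAt (f u v : ℂ × ℂ → ℂ) (p : ℂ × ℂ) : Prop :=
  AnalyticAt ℂ u p ∧ AnalyticAt ℂ v p ∧ (∃ᶠ z in 𝓝 p, v z ≠ 0) ∧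
    ∀ᶠ z in 𝓝 p, v z ≠ 0 → f z = u z / v z

/-- `f` is meromorphic on `Ω ⊆ ℂ²`: near every point of `Ω` it is a quotient of two holomorphic
functions. -/
def MeromorphicOnC2 (f : ℂ × ℂ → ℂ) (Ω : Set (ℂ × ℂ)) : Prop :=
  ∀ p ∈ Ω, ∃ u v : ℂ × ℂ → ℂ, IsQuotientAt f u v p

/-- The germ of `g` at `p` is divisible by `(ε - ε₀) ^ m` in the ring of germs of holomorphic
functions of `z = (t, ε)` at `p`. -/
def PowDvdAt (ε₀ : ℂ) (m : ℕ) (g : ℂ × ℂ → ℂ) (p : ℂ × ℂ) : Prop :=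
  ∃ w : ℂ × ℂ → ℂ, AnalyticAt ℂ w p ∧ ∀ᶠ z in 𝓝 p, g z = (z.2 - ε₀) ^ m * w z

/-- The function `f (t, ε)`, meromorphic for `t ∈ U` and `ε` near `ε₀`, is singularly perturbed at
`ε₀`: written as a quotient `u / v` of holomorphic functions near a point `(t₀, ε₀)`, its
denominator `v` is divisible by a power of `ε - ε₀` which does not divide its numerator `u`.
For connected `U` this depends neither on `t₀ ∈ U` nor on the choice of `u` and `v`. -/
def FunSingularlyPerturbedAt (U : Set ℂ) (f : ℂ × ℂ → ℂ) (ε₀ : ℂ) : Prop :=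
  ∃ t₀ ∈ U, ∃ u v : ℂ × ℂ → ℂ, IsQuotientAt f u v (t₀, ε₀) ∧
    ∃ m : ℕ, PowDvdAt ε₀ m v (t₀, ε₀) ∧ ¬ PowDvdAt ε₀ m u (t₀, ε₀)

/-- The functions `a 0, …, a n` are the coefficients of a linear differential equation
`a n * y⁽ⁿ⁾ + ⋯ + a 1 * y' + a 0 * y = 0` of order `n` in the variable `t`, with parameter `ε`,
meromorphic on `U × V`: all are meromorphic, and the leading one is not the zero meromorphic
function. -/
def IsMeromorphicODE {n : ℕ} (U V : Set ℂ) (a : Fin (n + 1) → ℂ × ℂ → ℂ) : Prop :=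
  (∀ k, MeromorphicOnC2 (a k) (U ×ˢ V)) ∧
    ∃ p ∈ U ×ˢ V, AnalyticAt ℂ (a (Fin.last n)) p ∧ a (Fin.last n) p ≠ 0

/-- The equation is singularly perturbed at `ε₀`: after division by the leading coefficient, at
least one of its coefficients is singularly perturbed at `ε₀`. -/
def ODESingularlyPerturbedAt {n : ℕ} (U : Set ℂ) (a : Fin (n + 1) → ℂ × ℂ → ℂ) (ε₀ : ℂ) : Prop :=
  ∃ k : Fin n, FunSingularlyPerturbedAt U (fun z => a k.castSucc z / a (Fin.last n) z) ε₀

/-- `y` is a solution of the equation, holomorphic in `(t, ε)` on `U × V`; the identity between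
meromorphic functions is required at the points where all coefficients are holomorphic, which
form a dense open subset of `U × V`. -/
def IsHolomorphicSolution {n : ℕ} (U V : Set ℂ) (a : Fin (n + 1) → ℂ × ℂ → ℂ)
    (y : ℂ × ℂ → ℂ) : Prop :=
  AnalyticOnNhd ℂ y (U ×ˢ V) ∧
    ∀ t ∈ U, ∀ ε ∈ V, (∀ k, AnalyticAt ℂ (a k) (t, ε)) →
      ∑ k : Fin (n + 1), a k (t, ε) * iteratedDeriv (k : ℕ) (fun s => y (s, ε)) t = 0

end SingularODE

/-! Suppose that `n` solutions are independent at some `ε₁`; a contradiction arises on the line `ε =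
ε₀`. Clear denominators and divide by the largest common power of `ε - ε₀`. Singular perturbation
then forces the leading coefficient to vanish on the line `ε = ε₀`, where some other coefficient
does not, so the restricted equation is nontrivial of order below `n` (`exists_reduced_equation`).
Combinations of solutions with coefficients depending only on `ε` are again solutions. Cramer's rule
supplies `n` of them which, divided by a power of `ε - ε₀`, remain independent at `ε₀`
(`exists_saturation`). Their restrictions solve the restricted equation, which has fewer than `n`
independent solutions (`exists_linear_relation`). -/

namespace SingularODE

/-! ### Division by `ε - ε₀` through power series -/

section Division

/-- The difference quotient in the second variable of an `(n + 1)`-linear form on `ℂ²`. -/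
noncomputable def sndDiffQuot {n : ℕ} (p : (ℂ × ℂ) [×(n + 1)]→L[ℂ] ℂ) : (ℂ × ℂ) [×n]→L[ℂ] ℂ :=
  ∑ i : Fin (n + 1), (p.compContinuousLinearMap fun j =>
    if j < i then (ContinuousLinearMap.inl ℂ ℂ ℂ).comp (ContinuousLinearMap.fst ℂ ℂ ℂ)
    else ContinuousLinearMap.id ℂ (ℂ × ℂ)).curryMid i (0, 1)

/-- The loss is only linear in the degree, so the quotient series keeps a positive radius. -/
lemma norm_sndDiffQuot_le {n : ℕ} (p : (ℂ × ℂ) [×(n + 1)]→L[ℂ] ℂ) :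
    ‖sndDiffQuot p‖ ≤ (n + 1) * ‖p‖ := by
  have key : ∀ i ∈ (Finset.univ : Finset (Fin (n + 1))), ‖(p.compContinuousLinearMap fun j =>
      if j < i then (ContinuousLinearMap.inl ℂ ℂ ℂ).comp (ContinuousLinearMap.fst ℂ ℂ ℂ)
      else ContinuousLinearMap.id ℂ (ℂ × ℂ)).curryMid i (0, 1)‖ ≤ ‖p‖ := by
    intro i _
    refine (ContinuousLinearMap.le_opNorm _ _).trans ?_
    have h1 : ‖((0 : ℂ), (1 : ℂ))‖ = 1 := by simp [Prod.norm_def]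
    rw [h1, mul_one, ContinuousMultilinearMap.norm_curryMid]
    refine (ContinuousMultilinearMap.norm_compContinuousLinearMap_le _ _).trans ?_
    refine mul_le_of_le_one_right (norm_nonneg _) (Finset.prod_le_one (fun _ _ => norm_nonneg _) ?_)
    intro j _
    split_ifs
    · refine ContinuousLinearMap.opNorm_le_bound _ zero_le_one fun x => ?_
      simp [Prod.norm_def]
    · exact ContinuousLinearMap.norm_id_le
  refine (norm_sum_le_of_le _ key).trans ?_
  simp

/-- The sum telescopes: slots change from `x` to `(x.1, 0)` one at a time, and by linearity each
change contributes `x.2` times a value with `(0, 1)` in that slot. -/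
lemma smul_sndDiffQuot {n : ℕ} (p : (ℂ × ℂ) [×(n + 1)]→L[ℂ] ℂ) (x : ℂ × ℂ) :
    x.2 * sndDiffQuot p (fun _ => x) = p (fun _ => x) - p (fun _ => (x.1, 0)) := by
  have hs : ∀ i : Fin (n + 1), x.2 * ((p.compContinuousLinearMap fun j =>
      if j < i then (ContinuousLinearMap.inl ℂ ℂ ℂ).comp (ContinuousLinearMap.fst ℂ ℂ ℂ)
      else ContinuousLinearMap.id ℂ (ℂ × ℂ)).curryMid i (0, 1)) (fun _ => x) =
      p (fun j => if (j : ℕ) < (i : ℕ) then (x.1, 0) else x) -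
        p (fun j => if (j : ℕ) < (i : ℕ) + 1 then (x.1, 0) else x) := by
    intro i
    set m : Fin (n + 1) → ℂ × ℂ := fun j => if (j : ℕ) < (i : ℕ) then (x.1, 0) else x with hm
    have e1 : m = Function.update m i x := by
      funext j
      by_cases h : j = i
      · subst h; simp [hm]
      · simp [h]
    have e2 : (fun j : Fin (n + 1) => if (j : ℕ) < (i : ℕ) + 1 then (x.1, (0 : ℂ)) else x)
        = Function.update m i (x.1, 0) := by
      funext j
      by_cases h : j = i
      · subst h; simp
      · have : (j : ℕ) ≠ i := fun h' => h (Fin.ext h')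
        have h2 : ((j : ℕ) < (i : ℕ) + 1) ↔ ((j : ℕ) < i) := by omega
        simp [h, hm, h2]
    have e3 : x - (x.1, 0) = x.2 • ((0 : ℂ), (1 : ℂ)) := by ext <;> simp
    rw [e2]
    nth_rewrite 1 [e1]
    rw [← ContinuousMultilinearMap.map_update_sub, e3, ContinuousMultilinearMap.map_update_smul,
      smul_eq_mul, ContinuousMultilinearMap.curryMid_apply,
      ContinuousMultilinearMap.compContinuousLinearMap_apply]
    congr 2
    funext j
    by_cases h : j = i
    · subst h; simp
    · obtain ⟨j', rfl⟩ := Fin.exists_succAbove_eq h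
      simp only [Fin.insertNth_apply_succAbove, hm, Function.update_of_ne h]
      by_cases h2 : i.succAbove j' < i
      · rw [if_pos h2, if_pos (Fin.lt_def.1 h2)]; simp
      · rw [if_neg h2, if_neg (fun h3 => h2 (Fin.lt_def.2 h3))]; simp
  rw [sndDiffQuot, _root_.sum_apply, Finset.mul_sum, Finset.sum_congr rfl
    (fun i _ => hs i), Fin.sum_univ_eq_sum_range (fun i : ℕ =>
      p (fun j => if (j : ℕ) < i then (x.1, 0) else x) -
        p (fun j => if (j : ℕ) < i + 1 then (x.1, 0) else x)), Finset.sum_range_sub']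
  congr 2
  funext j
  rw [if_pos j.2]

/-- A holomorphic germ on `ℂ²` that vanishes on the line `ε = ε₀` is divisible by `ε - ε₀`. -/
lemma exists_eq_sub_mul {F : ℂ × ℂ → ℂ} {p : ℂ × ℂ} (hF : AnalyticAt ℂ F p)
    (h0 : ∀ᶠ t in 𝓝 p.1, F (t, p.2) = 0) :
    ∃ G : ℂ × ℂ → ℂ, AnalyticAt ℂ G p ∧ ∀ᶠ z in 𝓝 p, F z = (z.2 - p.2) * G z := by
  obtain ⟨P, hP⟩ := hF
  let Q : FormalMultilinearSeries ℂ (ℂ × ℂ) ℂ := fun n => sndDiffQuot (P (n + 1))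
  obtain ⟨C, r, hC, hr, hb⟩ := P.le_mul_pow_of_radius_pos hP.radius_pos
  have hQ : 0 < Q.radius := by
    -- Halving `1 / r` absorbs the factor `n + 1 ≤ 2 ^ n`.
    let ρ : NNReal := ⟨1 / (2 * r), by positivity⟩
    have hρ : 0 < ρ := by
      rw [← NNReal.coe_pos]; change 0 < 1 / (2 * r); positivity
    refine lt_of_lt_of_le (ENNReal.coe_pos.2 hρ) (Q.le_radius_of_bound (C * r) fun n => ?_)
    have h1 : ‖Q n‖ ≤ (n + 1) * (C * r ^ (n + 1)) :=
      (norm_sndDiffQuot_le _).trans (mul_le_mul_of_nonneg_left (hb _) (by positivity))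
    have h2 : ((n : ℝ) + 1) ≤ 2 ^ n := by exact_mod_cast (Nat.lt_two_pow_self (n := n))
    calc ‖Q n‖ * (ρ : ℝ) ^ n ≤ (2 ^ n * (C * r ^ (n + 1))) * (1 / (2 * r)) ^ n := by
          refine mul_le_mul_of_nonneg_right (h1.trans ?_) (by positivity)
          exact mul_le_mul_of_nonneg_right h2 (by positivity)
      _ = C * r := by
          rw [div_pow, mul_pow, one_pow, pow_succ]; field_simp
  have hQs := Q.hasFPowerSeriesOnBall hQ
  have hsub : Tendsto (fun z : ℂ × ℂ => z - p) (𝓝 p) (𝓝 0) := by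
    have : Continuous (fun z : ℂ × ℂ => z - p) := by fun_prop
    simpa using this.tendsto p
  refine ⟨fun z => Q.sum (z - p), ?_, ?_⟩
  · refine AnalyticAt.fun_comp (g := Q.sum) ?_ (by fun_prop)
    rw [sub_self]; exact hQs.analyticAt
  · have hsum := (hP.eventually_hasSum_sub)
    have hproj : Tendsto (fun z : ℂ × ℂ => (z.1, p.2)) (𝓝 p) (𝓝 p) := by
      have : Continuous (fun z : ℂ × ℂ => (z.1, p.2)) := by fun_prop
      simpa using this.tendsto p
    have h0' : ∀ᶠ z : ℂ × ℂ in 𝓝 p, F (z.1, p.2) = 0 :=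
      (continuous_fst.tendsto p).eventually h0
    have hq : ∀ᶠ z in 𝓝 p, z - p ∈ Metric.eball (0 : ℂ × ℂ) Q.radius :=
      hsub.eventually (Metric.isOpen_eball.mem_nhds (by simpa using hQ))
    filter_upwards [hsum, hproj.eventually hsum, h0', hq] with z h1 h2 h3 h4
    have h5 := (Q.hasSum h4).mul_left (z.2 - p.2)
    -- The subtracted series sums to `F (z.1, p.2) = 0`; the constant terms cancel, and every other
    -- difference has the factor `z.2 - p.2`.
    have h6 := h1.sub h2
    rw [h3, sub_zero, ← hasSum_nat_add_iff' 1] at h6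
    have e0 : P 0 (fun _ => z - p) = P 0 (fun _ => (z.1, p.2) - p) := by
      congr 1; exact Subsingleton.elim _ _
    have e1 : ∀ n, P (n + 1) (fun _ => z - p) - P (n + 1) (fun _ => (z.1, p.2) - p) =
        (z.2 - p.2) * Q n fun _ => z - p := fun n => by
      have h8 : (z.1, p.2) - p = (z.1 - p.1, 0) := by ext <;> simp
      rw [h8]
      exact (smul_sndDiffQuot (P (n + 1)) (z - p)).symm
    have h7 : HasSum (fun n => (z.2 - p.2) * Q n fun _ => z - p) (F z) := by
      simpa only [e1, Finset.sum_range_one, e0, sub_self, sub_zero] using h6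
    exact h7.unique h5

end Division

/-! ### Holomorphic germs form an integral domain -/

section Germs

variable {E : Type*} [NormedAddCommGroup E] [NormedSpace ℂ E]

lemma eventually_frequently_ne_zero {F : E → ℂ} {p : E} (hF : AnalyticAt ℂ F p)
    (h : ∃ᶠ z in 𝓝 p, F z ≠ 0) : ∀ᶠ q in 𝓝 p, ∃ᶠ z in 𝓝 q, F z ≠ 0 := by
  obtain ⟨r, hr, hball⟩ := Metric.eventually_nhds_iff_ball.1 hF.eventually_analyticAt
  filter_upwards [Metric.ball_mem_nhds p hr] with q hq hcon
  refine h ?_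
  have := AnalyticOnNhd.eqOn_zero_of_preconnected_of_eventuallyEq_zero (U := Metric.ball p r)
    (fun z hz => hball z hz) (convex_ball p r).isPreconnected hq
    (by filter_upwards [hcon] with z hz; simpa using hz)
  filter_upwards [Metric.ball_mem_nhds p hr] with z hz
  simpa using this hz

/-- The frequency hypotheses say that the germs are nonzero. Near `p` there is a point where `F ≠
0`; the germ of `G` there is still nonzero by the identity theorem, and `F` stays nonzero around it.
-/
lemma frequently_mul_ne_zero {F G : E → ℂ} {p : E} (hF : AnalyticAt ℂ F p)
    (hG : AnalyticAt ℂ G p) (h : ∃ᶠ z in 𝓝 p, F z ≠ 0) (h' : ∃ᶠ z in 𝓝 p, G z ≠ 0) :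
    ∃ᶠ z in 𝓝 p, F z * G z ≠ 0 := by
  rw [← frequently_frequently_nhds]
  refine (h.and_eventually
    ((eventually_frequently_ne_zero hG h').and hF.eventually_analyticAt)).mono ?_
  rintro q ⟨h1, h2, h3⟩
  refine (h2.and_eventually (h3.continuousAt.eventually_ne h1)).mono ?_
  rintro z ⟨h4, h5⟩
  exact mul_ne_zero h5 h4

lemma frequently_prod_ne_zero {ι : Type*} (s : Finset ι) {F : ι → E → ℂ} {p : E}
    (hF : ∀ i, AnalyticAt ℂ (F i) p) (h : ∀ i, ∃ᶠ z in 𝓝 p, F i z ≠ 0) :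
    ∃ᶠ z in 𝓝 p, ∏ i ∈ s, F i z ≠ 0 := by
  classical
  induction s using Finset.induction_on with
  | empty => simp
  | insert i s hi ih =>
    simp only [Finset.prod_insert hi]
    exact frequently_mul_ne_zero (hF i) (Finset.analyticAt_fun_prod _ fun i _ => hF i) (h i) ih

lemma eventually_eq_zero_of_mul {F G : E → ℂ} {p : E} (hF : AnalyticAt ℂ F p)
    (hG : AnalyticAt ℂ G p) (h : ∃ᶠ z in 𝓝 p, F z ≠ 0) (h' : ∀ᶠ z in 𝓝 p, F z * G z = 0) :
    ∀ᶠ z in 𝓝 p, G z = 0 := by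
  by_contra hcon
  exact frequently_mul_ne_zero hF hG h (not_eventually.1 hcon) (h'.mono fun z hz => not_not.2 hz)

lemma analyticAt_snd_sub_pow (p q : ℂ × ℂ) (m : ℕ) :
    AnalyticAt ℂ (fun z : ℂ × ℂ => (z.2 - q.2) ^ m) p :=
  (analyticAt_snd.fun_sub analyticAt_const).fun_pow m

lemma frequently_sub_pow_ne_zero (p : ℂ × ℂ) (m : ℕ) :
    ∃ᶠ z in 𝓝 p, (z.2 - p.2) ^ m ≠ 0 := by
  have h1 : ∃ᶠ e in 𝓝 p.2, e ≠ p.2 :=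
    (eventually_mem_nhdsWithin (a := p.2) (s := {p.2}ᶜ)).frequently.filter_mono nhdsWithin_le_nhds
  have h2 : Tendsto (fun e : ℂ => (p.1, e)) (𝓝 p.2) (𝓝 p) := by
    have : Continuous (fun e : ℂ => (p.1, e)) := by fun_prop
    exact this.tendsto p.2
  exact h2.frequently (h1.mono fun e he => pow_ne_zero _ (sub_ne_zero.2 he))

lemma eventually_eq_zero_of_sub_pow_mul {G : ℂ × ℂ → ℂ} {p : ℂ × ℂ} {m : ℕ}
    (hG : AnalyticAt ℂ G p) (h : ∀ᶠ z in 𝓝 p, (z.2 - p.2) ^ m * G z = 0) :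
    ∀ᶠ z in 𝓝 p, G z = 0 :=
  eventually_eq_zero_of_mul (analyticAt_snd_sub_pow p p m) hG
    (frequently_sub_pow_ne_zero p m) h

end Germs

/-! ### Restriction to lines and derivatives in `t` -/

section Slices

lemma analyticAt_fst_slice {F : ℂ × ℂ → ℂ} {t ε : ℂ} (hF : AnalyticAt ℂ F (t, ε)) :
    AnalyticAt ℂ (fun s => F (s, ε)) t :=
  hF.fun_comp (f := fun s : ℂ => (s, ε)) (analyticAt_id.prod analyticAt_const)

lemma analyticAt_snd_slice {F : ℂ × ℂ → ℂ} {t ε : ℂ} (hF : AnalyticAt ℂ F (t, ε)) :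
    AnalyticAt ℂ (fun e => F (t, e)) ε :=
  hF.fun_comp (f := fun e : ℂ => (t, e)) (analyticAt_const.prod analyticAt_id)

lemma tendsto_fst_slice (p : ℂ × ℂ) : Tendsto (fun s : ℂ => (s, p.2)) (𝓝 p.1) (𝓝 p) := by
  have : Continuous (fun s : ℂ => (s, p.2)) := by fun_prop
  exact this.tendsto p.1

lemma tendsto_snd_slice (p : ℂ × ℂ) : Tendsto (fun e : ℂ => (p.1, e)) (𝓝 p.2) (𝓝 p) := by
  have : Continuous (fun e : ℂ => (p.1, e)) := by fun_prop
  exact this.tendsto p.2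

/-- The `k`-th partial derivative with respect to the first variable. -/
noncomputable def fstDeriv (k : ℕ) (y : ℂ × ℂ → ℂ) (z : ℂ × ℂ) : ℂ :=
  iteratedDeriv k (fun s => y (s, z.2)) z.1

/-- Joint analyticity is inherited inductively, the next derivative being the full derivative
applied to `(1, 0)`. -/
lemma analyticAt_fstDeriv {y : ℂ × ℂ → ℂ} {p : ℂ × ℂ} (hy : AnalyticAt ℂ y p) (k : ℕ) :
    AnalyticAt ℂ (fstDeriv k y) p := by
  induction k with
  | zero => exact hy
  | succ k ih =>
    have h1 : AnalyticAt ℂ (fun z => fderiv ℂ (fstDeriv k y) z (1, 0)) p :=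
      ((ContinuousLinearMap.apply ℂ ℂ ((1 : ℂ), (0 : ℂ))).analyticAt _).fun_comp ih.fderiv
    refine h1.congr ?_
    filter_upwards [ih.eventually_analyticAt] with z hz
    have h2 : HasDerivAt (fun s : ℂ => (s, z.2)) ((1 : ℂ), (0 : ℂ)) z.1 :=
      (hasDerivAt_id z.1).prodMk (hasDerivAt_const z.1 z.2)
    have h3 := (hz.differentiableAt.hasFDerivAt (x := z)).comp_hasDerivAt z.1 h2
    rw [fstDeriv, iteratedDeriv_succ]
    exact h3.deriv.symm

lemma fstDeriv_congr {y y' : ℂ × ℂ → ℂ} {p : ℂ × ℂ} (h : y =ᶠ[𝓝 p] y') (k : ℕ) :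
    fstDeriv k y =ᶠ[𝓝 p] fstDeriv k y' := by
  filter_upwards [h.eventually_nhds] with z hz
  exact Filter.EventuallyEq.iteratedDeriv_eq k ((tendsto_fst_slice z).eventually hz)

lemma fstDeriv_snd_mul (c : ℂ → ℂ) (y : ℂ × ℂ → ℂ) (k : ℕ) (z : ℂ × ℂ) :
    fstDeriv k (fun z => c z.2 * y z) z = c z.2 * fstDeriv k y z :=
  iteratedDeriv_const_mul_field (c z.2) fun s => y (s, z.2)

end Slices

/-! ### Divisibility by powers of `ε - ε₀` -/

section PowDvd

/-- If `ε - ε₀` does not divide `b`, then a power of `ε - ε₀` dividing `u * b` divides `u`. -/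
lemma powDvdAt_of_mul {p : ℂ × ℂ} {u b w : ℂ × ℂ → ℂ} {m : ℕ} (hu : AnalyticAt ℂ u p)
    (hb : AnalyticAt ℂ b p) (hw : AnalyticAt ℂ w p) (hb0 : ∃ᶠ t in 𝓝 p.1, b (t, p.2) ≠ 0)
    (h : ∀ᶠ z in 𝓝 p, u z * b z = (z.2 - p.2) ^ m * w z) : PowDvdAt p.2 m u p := by
  induction m generalizing u with
  | zero => exact ⟨u, hu, by simp⟩
  | succ m ih =>
    -- On the line `ε = ε₀` the product `u * b` vanishes and `b` is not identically zero, so one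
    -- factor splits off `u`.
    have h0 : ∀ᶠ t in 𝓝 p.1, u (t, p.2) = 0 := by
      refine eventually_eq_zero_of_mul (analyticAt_fst_slice hb) (analyticAt_fst_slice hu) hb0 ?_
      filter_upwards [(tendsto_fst_slice p).eventually h] with t ht
      rw [mul_comm, ht]; simp
    obtain ⟨u', hu', hu'e⟩ := exists_eq_sub_mul hu h0
    have h1 : ∀ᶠ z in 𝓝 p, u' z * b z - (z.2 - p.2) ^ m * w z = 0 := by
      refine eventually_eq_zero_of_sub_pow_mul (m := 1)
        ((hu'.fun_mul hb).fun_sub ((analyticAt_snd_sub_pow p p m).fun_mul hw)) ?_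
      filter_upwards [h, hu'e] with z h2 h3
      rw [h3] at h2
      linear_combination h2
    obtain ⟨w', hw', hw'e⟩ := ih hu' (h1.mono fun z hz => sub_eq_zero.1 hz)
    refine ⟨w', hw', ?_⟩
    filter_upwards [hu'e, hw'e] with z h2 h3
    rw [h2, h3]; ring

/-- Divisibility by a power of `ε - ε₀` can be tested on the lines `t = const`. -/
lemma powDvdAt_of_analyticOrderAt {p : ℂ × ℂ} {F : ℂ × ℂ → ℂ} {m : ℕ} (hF : AnalyticAt ℂ F p)
    (h : ∀ᶠ t in 𝓝 p.1, (m : ℕ∞) ≤ analyticOrderAt (fun e => F (t, e)) p.2) :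
    PowDvdAt p.2 m F p := by
  induction m generalizing F with
  | zero => exact ⟨F, hF, by simp⟩
  | succ m ih =>
    obtain ⟨G, hG, hGe⟩ := exists_eq_sub_mul hF (h.mono fun t ht => by
      refine apply_eq_zero_of_analyticOrderAt_ne_zero (f := fun e => F (t, e)) fun h0 => ?_
      rw [h0] at ht
      simp at ht)
    have hG' : PowDvdAt p.2 m G p := by
      refine ih hG ?_
      filter_upwards [h, (tendsto_fst_slice p).eventually hGe.eventually_nhds,
        (tendsto_fst_slice p).eventually hG.eventually_analyticAt] with t h1 h2 h3
      have h4 : (fun e => F (t, e)) =ᶠ[𝓝 p.2] (fun e => e - p.2) * fun e => G (t, e) :=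
        (tendsto_snd_slice (t, p.2)).eventually h2
      rw [analyticOrderAt_congr h4, analyticOrderAt_mul (by fun_prop) (analyticAt_snd_slice h3)]
        at h1
      have h5 : analyticOrderAt (fun e : ℂ => e - p.2) p.2 = 1 := by
        simp
      rw [h5, add_comm, Nat.cast_add, Nat.cast_one] at h1
      exact (ENat.add_le_add_iff_left (by simp)).1 h1
    obtain ⟨w, hw, hwe⟩ := hG'
    refine ⟨w, hw, ?_⟩
    filter_upwards [hGe, hwe] with z h2 h3
    rw [h2, h3]; ring

/-- A non-zero germ is not divisible by arbitrarily high powers of `ε - ε₀`. -/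
lemma exists_not_powDvdAt {p : ℂ × ℂ} {F : ℂ × ℂ → ℂ} (hF : AnalyticAt ℂ F p)
    (h : ∃ᶠ z in 𝓝 p, F z ≠ 0) : ∃ m, ¬ PowDvdAt p.2 m F p := by
  by_contra! hcon
  obtain ⟨r, hr, hball⟩ := Metric.eventually_nhds_iff_ball.1 hF.eventually_analyticAt
  obtain ⟨q, hq0, hq⟩ := (h.and_eventually (Metric.ball_mem_nhds p hr)).exists
  -- On the complex line through `p` and `q`, divisibility by all powers becomes infinite order at
  -- `0`, contradicting `F q ≠ 0`.
  let L : ℂ → ℂ × ℂ := fun x => p + x • (q - p)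
  have hL : Continuous L := by fun_prop
  let S : Set ℂ := L ⁻¹' Metric.ball p r
  have hS : IsPreconnected S := by
    refine Convex.isPreconnected ?_
    let A : ℂ →ᵃ[ℝ] ℂ × ℂ := ((LinearMap.toSpanSingleton ℂ (ℂ × ℂ) (q - p)).restrictScalars
      ℝ).toAffineMap + AffineMap.const ℝ ℂ p
    have : S = A ⁻¹' Metric.ball p r := by
      ext x; simp [S, L, A, add_comm]
    rw [this]
    exact (convex_ball p r).affine_preimage A
  have h0 : (0 : ℂ) ∈ S := by simp [S, L, hr]
  have h1 : (1 : ℂ) ∈ S := by simpa [S, L] using hq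
  have hg : AnalyticOnNhd ℂ (F ∘ L) S := fun x hx =>
    (hball _ hx).comp (by fun_prop : AnalyticAt ℂ L x)
  have htop : analyticOrderAt (F ∘ L) 0 = ⊤ := by
    refine ENat.eq_top_iff_forall_ge.2 fun m => ?_
    obtain ⟨w, hw, hwe⟩ := hcon m
    have hL0 : L 0 = p := by simp [L]
    rw [natCast_le_analyticOrderAt (hg 0 h0)]
    refine ⟨fun x => (q.2 - p.2) ^ m * w (L x), ?_, ?_⟩
    · refine AnalyticAt.fun_mul analyticAt_const (AnalyticAt.fun_comp ?_ (by fun_prop))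
      rwa [hL0]
    · have := hL.tendsto 0
      rw [hL0] at this
      filter_upwards [this.eventually hwe] with x hx
      rw [Function.comp_apply, hx]
      simp [L, mul_pow, mul_assoc]
  have := hg.eqOn_zero_of_preconnected_of_eventuallyEq_zero hS h0 (analyticOrderAt_eq_top.1 htop) h1
  exact hq0 (by simpa [L] using this)

/-- Finitely many germs, not all zero, can be divided by a common power of `ε - ε₀` so that not
all of the quotients are divisible by `ε - ε₀`. -/
lemma exists_primitive {ι : Type*} {p : ℂ × ℂ} {b : ι → ℂ × ℂ → ℂ}
    (hb : ∀ i, AnalyticAt ℂ (b i) p) {i₀ : ι} (h : ∃ᶠ z in 𝓝 p, b i₀ z ≠ 0) :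
    ∃ (m : ℕ) (b' : ι → ℂ × ℂ → ℂ), (∀ i, AnalyticAt ℂ (b' i) p) ∧
      (∀ i, ∀ᶠ z in 𝓝 p, b i z = (z.2 - p.2) ^ m * b' i z) ∧
      ∃ i, ∃ᶠ t in 𝓝 p.1, b' i (t, p.2) ≠ 0 := by
  classical
  have hex : ∃ m, ¬ ∀ i, PowDvdAt p.2 m (b i) p := by
    obtain ⟨m, hm⟩ := exists_not_powDvdAt (hb i₀) h
    exact ⟨m, fun h' => hm (h' i₀)⟩
  obtain ⟨m, hm⟩ : ∃ m, Nat.find hex = m + 1 := by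
    refine Nat.exists_eq_succ_of_ne_zero fun h0 => ?_
    have := Nat.find_spec hex
    rw [h0] at this
    exact this fun i => ⟨b i, hb i, by simp⟩
  have h1 : ∀ i, PowDvdAt p.2 m (b i) p := by
    by_contra hc
    have := Nat.find_min' hex hc
    omega
  have h2 : ¬ ∀ i, PowDvdAt p.2 (m + 1) (b i) p := hm ▸ Nat.find_spec hex
  choose b' hb' hbe using h1
  refine ⟨m, b', hb', hbe, ?_⟩
  by_contra! hc
  refine h2 fun i => ?_
  obtain ⟨w, hw, hwe⟩ := exists_eq_sub_mul (hb' i) (by simpa using hc i)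
  refine ⟨w, hw, ?_⟩
  filter_upwards [hbe i, hwe] with z h3 h4
  rw [h3, h4]; ring

end PowDvd

/-! ### Linear differential equations in one variable -/

section OneVariable

lemma le_analyticOrderAt_sum {ι : Type*} (s : Finset ι) {f : ι → ℂ → ℂ} {x : ℂ} {m : ℕ∞}
    (h : ∀ i ∈ s, m ≤ analyticOrderAt (f i) x) :
    m ≤ analyticOrderAt (∑ i ∈ s, f i) x := by
  classical
  induction s using Finset.induction_on with
  | empty =>
    have : analyticOrderAt (∑ i ∈ (∅ : Finset ι), f i) x = ⊤ :=
      analyticOrderAt_eq_top.2 (by simp)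
    rw [this]; exact le_top
  | insert i s hi ih =>
    rw [Finset.sum_insert hi]
    exact (le_min (h i (Finset.mem_insert_self i s))
      (ih fun j hj => h j (Finset.mem_insert_of_mem hj))).trans le_analyticOrderAt_add

lemma analyticOrderAt_iteratedDeriv {w : ℂ → ℂ} {x : ℂ} (hw : AnalyticAt ℂ w x) {N k : ℕ}
    (hN : analyticOrderAt w x = N) (hk : k ≤ N) :
    analyticOrderAt (iteratedDeriv k w) x = (N - k : ℕ) := by
  rcases eq_or_ne N 0 with rfl | h0
  · obtain rfl : k = 0 := by omega
    simpa using hN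
  · rw [iteratedDeriv_eq_iterate]
    exact analyticOrderAt_iterated_deriv hw hN.symm h0 hk

/-- A solution of a linear differential equation of exact order `K` at the regular point `x` is
determined by its first `K` derivatives at `x`. -/
lemma eventually_eq_zero_of_ode {n : ℕ} {β : Fin (n + 1) → ℂ → ℂ} {w : ℂ → ℂ} {x : ℂ}
    (hβ : ∀ k, AnalyticAt ℂ (β k) x) (hw : AnalyticAt ℂ w x) (K : Fin (n + 1)) (hK : β K x ≠ 0)
    (hgt : ∀ k, K < k → ∀ᶠ t in 𝓝 x, β k t = 0)
    (heq : ∀ᶠ t in 𝓝 x, ∑ k, β k t * iteratedDeriv (k : ℕ) w t = 0)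
    (hjet : ∀ i < (K : ℕ), iteratedDeriv i w x = 0) : ∀ᶠ t in 𝓝 x, w t = 0 := by
  rw [← analyticOrderAt_eq_top]
  by_contra htop
  set N := analyticOrderNatAt w x
  have hN : analyticOrderAt w x = N := (Nat.cast_analyticOrderNatAt htop).symm
  have hKN : (K : ℕ) ≤ N := by
    have := (natCast_le_analyticOrderAt_iff_iteratedDeriv_eq_zero hw).2 hjet
    rw [hN] at this
    exact_mod_cast this
  have hd : ∀ k, AnalyticAt ℂ (iteratedDeriv k w) x := fun k => by
    rw [iteratedDeriv_eq_iterate]; exact hw.iterated_deriv k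
  -- With `N` the order of `w`, the `K`-th term has order exactly `N - K` and all others have larger
  -- order, so they cannot cancel it.
  have hother : ∀ k ∈ Finset.univ.erase K, ((N - K + 1 : ℕ) : ℕ∞) ≤
      analyticOrderAt (β k * iteratedDeriv (k : ℕ) w) x := by
    intro k hk
    rcases lt_or_gt_of_ne (Finset.ne_of_mem_erase hk) with h | h
    · have h' : (k : ℕ) < K := h
      rw [analyticOrderAt_mul (hβ k) (hd k), analyticOrderAt_iteratedDeriv hw hN (by omega)]
      refine le_trans ?_ le_add_self
      exact_mod_cast (by omega : N - K + 1 ≤ N - k)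
    · rw [analyticOrderAt_mul_eq_top_of_left (analyticOrderAt_eq_top.2 (hgt k h))]
      exact le_top
  have hlead : analyticOrderAt (β K * iteratedDeriv (K : ℕ) w) x = (N - K : ℕ) := by
    rw [analyticOrderAt_mul (hβ K) (hd K), analyticOrderAt_iteratedDeriv hw hN hKN,
      (hβ K).analyticOrderAt_eq_zero.2 hK, zero_add]
  have hsum : β K * iteratedDeriv (K : ℕ) w =ᶠ[𝓝 x]
      -∑ k ∈ Finset.univ.erase K, β k * iteratedDeriv (k : ℕ) w := by
    filter_upwards [heq] with t ht
    rw [← Finset.add_sum_erase _ _ (Finset.mem_univ K)] at ht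
    simpa using eq_neg_of_add_eq_zero_left ht
  have := le_analyticOrderAt_sum _ hother
  rw [← analyticOrderAt_neg, ← analyticOrderAt_congr hsum, hlead] at this
  have : N - K + 1 ≤ N - K := by exact_mod_cast this
  omega

/-- A linear differential equation whose coefficients are not all zero and whose coefficient of
`w⁽ⁿ⁾` is zero has at most `n - 1` linearly independent solutions. -/
lemma exists_linear_relation {n : ℕ} {β : Fin (n + 1) → ℂ → ℂ} {z : Fin n → ℂ → ℂ} {x : ℂ}
    (hβ : ∀ k, AnalyticAt ℂ (β k) x) (hz : ∀ j, AnalyticAt ℂ (z j) x)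
    (hlast : ∀ᶠ t in 𝓝 x, β (Fin.last n) t = 0) (hne : ∃ k, ∃ᶠ t in 𝓝 x, β k t ≠ 0)
    (heq : ∀ j, ∀ᶠ t in 𝓝 x, ∑ k, β k t * iteratedDeriv (k : ℕ) (z j) t = 0) :
    ∃ᶠ q in 𝓝 x, ∃ c : Fin n → ℂ, c ≠ 0 ∧ ∀ᶠ t in 𝓝 q, ∑ j, c j * z j t = 0 := by
  classical
  -- `K < n` is the true order. Since `β K` may vanish at `x`, the relation is found at nearby
  -- points `q`.
  obtain ⟨K, hK, hmax⟩ := (Finset.univ.filter fun k => ∃ᶠ t in 𝓝 x, β k t ≠ 0).exists_max_image id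
    (by obtain ⟨k, hk⟩ := hne; exact ⟨k, by simpa using hk⟩)
  replace hK : ∃ᶠ t in 𝓝 x, β K t ≠ 0 := by simpa using hK
  have hgt : ∀ k, K < k → ∀ᶠ t in 𝓝 x, β k t = 0 := fun k hk => by
    by_contra hc
    exact (hmax k (by simpa using hc)).not_gt hk
  have hKn : (K : ℕ) < n := by
    refine lt_of_le_of_ne (Nat.le_of_lt_succ K.2) fun h => hK ?_
    obtain rfl : K = Fin.last n := Fin.ext h
    exact hlast.mono fun t ht => not_not.2 ht
  have hgood : ∀ᶠ q in 𝓝 x, (∀ k, AnalyticAt ℂ (β k) q) ∧ (∀ j, AnalyticAt ℂ (z j) q) ∧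
      (∀ k, K < k → ∀ᶠ t in 𝓝 q, β k t = 0) ∧
      ∀ j, ∀ᶠ t in 𝓝 q, ∑ k, β k t * iteratedDeriv (k : ℕ) (z j) t = 0 := by
    refine (eventually_all.2 fun k => (hβ k).eventually_analyticAt).and
      ((eventually_all.2 fun j => (hz j).eventually_analyticAt).and
      ((eventually_all.2 fun k => ?_).and (eventually_all.2 fun j => (heq j).eventually_nhds)))
    by_cases hk : K < k
    · filter_upwards [(hgt k hk).eventually_nhds] with q hq _ using hq
    · exact Eventually.of_forall fun _ h => absurd h hk
  refine (hK.and_eventually hgood).mono ?_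
  rintro q ⟨hq, h1, h2, h3, h4⟩
  -- Only `K < n` initial values are prescribed at `q`, so some nonzero combination has all of them
  -- zero.
  let J : (Fin n → ℂ) →ₗ[ℂ] (Fin K → ℂ) :=
    Matrix.mulVecLin (Matrix.of fun (i : Fin K) (j : Fin n) => iteratedDeriv (i : ℕ) (z j) q)
  obtain ⟨c, hc, hc0⟩ := Submodule.exists_mem_ne_zero_of_ne_bot
    (J.ker_ne_bot_of_finrank_lt (by simpa using hKn))
  have hder : ∀ (k : ℕ) (t : ℂ), (∀ j, AnalyticAt ℂ (z j) t) →
      iteratedDeriv k (fun t => ∑ j, c j * z j t) t = ∑ j, c j * iteratedDeriv k (z j) t := by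
    intro k t ht
    rw [iteratedDeriv_fun_sum fun j _ => (analyticAt_const.fun_mul (ht j)).contDiffAt]
    exact Finset.sum_congr rfl fun j _ => iteratedDeriv_const_mul_field _ _
  refine ⟨c, hc0, eventually_eq_zero_of_ode h1
    (Finset.analyticAt_fun_sum _ fun j _ => analyticAt_const.fun_mul (h2 j)) K hq h3 ?_ ?_⟩
  · filter_upwards [eventually_all.2 h4, eventually_all.2 fun j => (h2 j).eventually_analyticAt]
      with t ht ht'
    simp only [hder _ t ht', Finset.mul_sum]
    rw [Finset.sum_comm]
    refine Finset.sum_eq_zero fun j _ => ?_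
    rw [← mul_zero (c j), ← ht j, Finset.mul_sum]
    exact Finset.sum_congr rfl fun k _ => by ring
  · intro i hi
    rw [hder i q h2]
    have := congrFun (LinearMap.mem_ker.1 hc) ⟨i, hi⟩
    simpa [J, Matrix.mulVec, dotProduct, mul_comm] using this

end OneVariable

/-! ### Separating independent functions by points -/

section LinearAlgebra

/-- Linearly independent functions can be separated by finitely many points. -/
lemma exists_det_ne_zero {X : Type*} {n : ℕ} {g : Fin n → X → ℂ} (hg : LinearIndependent ℂ g) :
    ∃ τ : Fin n → X, (Matrix.of fun i j => g i (τ j)).det ≠ 0 := by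
  let w : X → Fin n → ℂ := fun x i => g i x
  -- A functional killing all value vectors `w x` would be a linear relation among the `g i`.
  have htop : Submodule.span ℂ (Set.range w) = ⊤ := by
    by_contra hne
    obtain ⟨φ, hφ, hle⟩ := Submodule.exists_le_ker_of_lt_top _ (lt_top_iff_ne_top.2 hne)
    refine hφ (LinearMap.pi_ext' fun i => LinearMap.ext_ring ?_)
    have h1 : ∑ i, φ (Pi.single i 1) • g i = 0 := by
      funext x
      have h2 : φ (w x) = 0 := hle (Submodule.subset_span ⟨x, rfl⟩)
      rw [LinearMap.pi_apply_eq_sum_univ φ (w x)] at h2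
      rw [Finset.sum_apply, Pi.zero_apply, ← h2]
      refine Finset.sum_congr rfl fun i _ => ?_
      rw [Pi.smul_apply, smul_eq_mul, smul_eq_mul, mul_comm]
      congr 2
      funext j; simp [Pi.single_apply, eq_comm]
    simpa using Fintype.linearIndependent_iff.1 hg _ h1 i
  obtain ⟨f, hf, -, hli⟩ := Submodule.exists_fun_fin_finrank_span_eq ℂ (Set.range w)
  have hcard : Module.finrank ℂ (Submodule.span ℂ (Set.range w)) = n := by
    rw [htop, finrank_top, Module.finrank_fin_fun]
  choose τ hτ using hf
  refine ⟨fun j => τ (Fin.cast hcard.symm j), ?_⟩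
  have h1 : LinearIndependent ℂ fun j : Fin n => w (τ (Fin.cast hcard.symm j)) := by
    simp only [hτ]
    exact hli.comp _ (Fin.cast_injective _)
  rw [← Matrix.det_transpose]
  exact (Matrix.isUnit_iff_isUnit_det _).1 (Matrix.linearIndependent_rows_iff_isUnit.1 h1) |>.ne_zero

end LinearAlgebra

/-! ### The reduced equation -/

lemma fstDeriv_sum_snd_mul {n : ℕ} {g : Fin n → ℂ × ℂ → ℂ} (C : Fin n → ℂ → ℂ) (k : ℕ)
    {z : ℂ × ℂ} (hg : ∀ l, AnalyticAt ℂ (g l) z) :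
    fstDeriv k (fun z => ∑ l, C l z.2 * g l z) z = ∑ l, C l z.2 * fstDeriv k (g l) z := by
  have h1 : fstDeriv k (fun z => ∑ l, C l z.2 * g l z) z =
      ∑ l, fstDeriv k (fun z => C l z.2 * g l z) z :=
    iteratedDeriv_fun_sum (f := fun l s => C l z.2 * g l (s, z.2)) fun l _ =>
      (analyticAt_const.fun_mul (analyticAt_fst_slice (hg l))).contDiffAt
  rw [h1]
  exact Finset.sum_congr rfl fun l _ => fstDeriv_snd_mul (C l) (g l) k z

/-- Near a point of the line `ε = ε₀` a singularly perturbed equation implies one with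
holomorphic coefficients which, on that line, are not all zero while the leading one is. -/
lemma exists_reduced_equation {n : ℕ} {U V : Set ℂ} (hU : IsOpen U) (hV : IsOpen V)
    {a : Fin (n + 1) → ℂ × ℂ → ℂ} (ha : ∀ k, MeromorphicOnC2 (a k) (U ×ˢ V)) {p : ℂ × ℂ}
    (hp : p ∈ U ×ˢ V) {k₀ : Fin n} {u v : ℂ × ℂ → ℂ}
    (huv : IsQuotientAt (fun z => a k₀.castSucc z / a (Fin.last n) z) u v p) {m : ℕ}
    (hv : PowDvdAt p.2 m v p) (hu : ¬ PowDvdAt p.2 m u p) :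
    ∃ b : Fin (n + 1) → ℂ × ℂ → ℂ, (∀ k, AnalyticAt ℂ (b k) p) ∧
      (∃ k, ∃ᶠ t in 𝓝 p.1, b k (t, p.2) ≠ 0) ∧ (∀ᶠ t in 𝓝 p.1, b (Fin.last n) (t, p.2) = 0) ∧
      ∀ y, IsHolomorphicSolution U V a y →
        ∀ᶠ z in 𝓝 p, ∑ k, b k z * fstDeriv (k : ℕ) y z = 0 := by
  classical
  choose num den hnum hden hden0 hquot using fun k => ha k p hp
  obtain ⟨hua, hva, hv0, hf⟩ := huv
  let P : ℂ × ℂ → ℂ := fun z => ∏ k, den k z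
  have hP : AnalyticAt ℂ P p := Finset.analyticAt_fun_prod _ fun k _ => hden k
  have hP0 : ∃ᶠ z in 𝓝 p, P z ≠ 0 := frequently_prod_ne_zero _ hden hden0
  let b : Fin (n + 1) → ℂ × ℂ → ℂ := fun k z => num k z * ∏ j ∈ Finset.univ.erase k, den j z
  have hb : ∀ k, AnalyticAt ℂ (b k) p := fun k =>
    (hnum k).fun_mul (Finset.analyticAt_fun_prod _ fun j _ => hden j)
  have hbP : ∀ᶠ z in 𝓝 p, P z ≠ 0 → ∀ k, b k z = P z * a k z := by
    filter_upwards [eventually_all.2 hquot] with z hz hPz k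
    have hk : den k z ≠ 0 := Finset.prod_ne_zero_iff.1 hPz k (Finset.mem_univ k)
    rw [hz k hk]
    change _ = (∏ j, den j z) * _
    rw [← Finset.mul_prod_erase _ _ (Finset.mem_univ k)]
    field_simp
    exact mul_comm _ _
  have ha_an : ∀ᶠ z in 𝓝 p, P z ≠ 0 → ∀ k, AnalyticAt ℂ (a k) z := by
    filter_upwards [(eventually_all.2 hquot).eventually_nhds,
      eventually_all.2 fun k => (hnum k).eventually_analyticAt,
      eventually_all.2 fun k => (hden k).eventually_analyticAt] with z h1 h2 h3 hPz k
    have hk : den k z ≠ 0 := Finset.prod_ne_zero_iff.1 hPz k (Finset.mem_univ k)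
    refine ((h2 k).fun_div (h3 k) hk).congr ?_
    filter_upwards [h1, (h3 k).continuousAt.eventually_ne hk] with z' h4 h5
    exact (h4 k h5).symm
  have heq : ∀ y, IsHolomorphicSolution U V a y →
      ∀ᶠ z in 𝓝 p, ∑ k, b k z * fstDeriv (k : ℕ) y z = 0 := by
    intro y hy
    -- The equation is only known where `P ≠ 0`; multiplying by `P` removes this restriction.
    refine eventually_eq_zero_of_mul hP (Finset.analyticAt_fun_sum _ fun k _ =>
      (hb k).fun_mul (analyticAt_fstDeriv (hy.1 p hp) k)) hP0 ?_
    filter_upwards [hbP, ha_an, (hU.prod hV).mem_nhds hp] with z h1 h2 h3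
    rcases eq_or_ne (P z) 0 with h0 | h0
    · rw [h0, zero_mul]
    · rw [mul_eq_zero]; right
      have := hy.2 z.1 h3.1 z.2 h3.2 (h2 h0)
      rw [← mul_zero (P z), ← this, Finset.mul_sum]
      exact Finset.sum_congr rfl fun k _ => by rw [h1 h0 k, mul_assoc]; rfl
  -- Otherwise the convention `x / 0 = 0` would give `u = 0`, which every power divides.
  have hlast : ∃ᶠ z in 𝓝 p, b (Fin.last n) z ≠ 0 := by
    intro hcon
    have hu0 : ∀ᶠ z in 𝓝 p, u z = 0 := by
      refine eventually_eq_zero_of_mul (hP.fun_mul hva) hua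
        (frequently_mul_ne_zero hP hva hP0 hv0) ?_
      filter_upwards [hbP, hcon, hf] with z h1 h2 h3
      rcases eq_or_ne (P z) 0 with h0 | h0
      · simp [h0]
      rcases eq_or_ne (v z) 0 with h0' | h0'
      · simp [h0']
      have h4 : a (Fin.last n) z = 0 := by
        have := h1 h0 (Fin.last n)
        rw [not_not.1 h2] at this
        exact (mul_eq_zero.1 this.symm).resolve_left h0
      have h5 := h3 h0'
      rw [h4, div_zero, eq_comm, div_eq_zero_iff] at h5
      rw [h5.resolve_right h0', mul_zero]
    exact hu ⟨fun _ => 0, analyticAt_const, hu0.mono fun z hz => by simp [hz]⟩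
  obtain ⟨M, b', hb', hbb', hprim⟩ := exists_primitive hb hlast
  refine ⟨b', hb', hprim, ?_, fun y hy => ?_⟩
  -- Here `u * b' n = v * b' k₀`. Were `b' n` nonzero on the line, the power dividing `v` would
  -- divide `u`.
  · by_contra hcon
    obtain ⟨w, hw, hvw⟩ := hv
    have h1 : ∀ᶠ z in 𝓝 p, u z * b (Fin.last n) z - v z * b k₀.castSucc z = 0 := by
      refine eventually_eq_zero_of_mul ((hP.fun_mul hva).fun_mul (hb (Fin.last n)))
        ((hua.fun_mul (hb _)).fun_sub (hva.fun_mul (hb _)))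
        (frequently_mul_ne_zero (hP.fun_mul hva) (hb _)
          (frequently_mul_ne_zero hP hva hP0 hv0) hlast) ?_
      filter_upwards [hbP, hf] with z h1 h3
      rcases eq_or_ne (P z) 0 with h0 | h0
      · simp [h0]
      rcases eq_or_ne (v z) 0 with h0' | h0'
      · simp [h0']
      rcases eq_or_ne (b (Fin.last n) z) 0 with hb0 | hb0
      · simp [hb0]
      have ha0 : a (Fin.last n) z ≠ 0 := fun h => hb0 (by rw [h1 h0, h, mul_zero])
      have h5 := h3 h0'
      rw [div_eq_div_iff ha0 h0'] at h5
      rw [h1 h0, h1 h0]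
      linear_combination (-(P z * v z * (P z * a (Fin.last n) z)) * P z) * h5
    have h2 : ∀ᶠ z in 𝓝 p, u z * b' (Fin.last n) z - v z * b' k₀.castSucc z = 0 := by
      refine eventually_eq_zero_of_sub_pow_mul (m := M)
        ((hua.fun_mul (hb' _)).fun_sub (hva.fun_mul (hb' _))) ?_
      filter_upwards [h1, hbb' (Fin.last n), hbb' k₀.castSucc] with z h3 h4 h5
      rw [h4, h5] at h3
      linear_combination h3
    refine hu (powDvdAt_of_mul hua (hb' (Fin.last n)) (hw.fun_mul (hb' k₀.castSucc))
      (not_eventually.1 hcon) ?_)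
    filter_upwards [h2, hvw] with z h3 h4
    rw [h4] at h3
    linear_combination h3
  · refine eventually_eq_zero_of_sub_pow_mul (m := M) (Finset.analyticAt_fun_sum _ fun k _ =>
      (hb' k).fun_mul (analyticAt_fstDeriv (hy.1 p hp) k)) ?_
    filter_upwards [heq y hy, eventually_all.2 hbb'] with z h1 h2
    rw [← h1, Finset.mul_sum]
    exact Finset.sum_congr rfl fun k _ => by rw [h2 k, mul_assoc]

/-! ### Saturation at `ε₀` by Cramer's rule -/

lemma analyticAt_det {n : ℕ} {M : ℂ → Matrix (Fin n) (Fin n) ℂ} {x : ℂ}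
    (h : ∀ i j, AnalyticAt ℂ (fun e => M e i j) x) : AnalyticAt ℂ (fun e => (M e).det) x := by
  simp only [Matrix.det_apply]
  refine Finset.analyticAt_fun_sum _ fun σ _ => ?_
  simp only [Units.smul_def, zsmul_eq_mul]
  exact analyticAt_const.fun_mul (Finset.analyticAt_fun_prod _ fun i _ => h _ _)

lemma analyticAt_adjugate {n : ℕ} {M : ℂ → Matrix (Fin n) (Fin n) ℂ} {x : ℂ}
    (h : ∀ i j, AnalyticAt ℂ (fun e => M e i j) x) (i j : Fin n) :
    AnalyticAt ℂ (fun e => (M e).adjugate i j) x := by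
  simp only [Matrix.adjugate_apply]
  refine analyticAt_det fun i' j' => ?_
  by_cases hi : i' = j
  · subst hi; simp only [Matrix.updateRow_self]; exact analyticAt_const
  · simp only [Matrix.updateRow_ne hi]; exact h i' j'

/-- Functions `g₁, …, gₙ` of `(t, ε)` which are linearly independent as functions of `t` for one
value of `ε` have `n` combinations with coefficients depending on `ε` which, after division by a
common power of `ε - ε₀`, are linearly independent at `ε₀`. -/
lemma exists_saturation {n : ℕ} {U V : Set ℂ} (hU : IsOpen U) (hVc : IsPreconnected V)
    {g : Fin n → ℂ × ℂ → ℂ} (hg : ∀ i, AnalyticOnNhd ℂ (g i) (U ×ˢ V)) {ε₀ ε₁ : ℂ}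
    (hε₀ : ε₀ ∈ V) (hε₁ : ε₁ ∈ V) (hli : LinearIndependent ℂ fun i => fun t : U => g i (t, ε₁)) :
    ∃ (m : ℕ) (C : Fin n → Fin n → ℂ → ℂ) (z : Fin n → ℂ → ℂ),
      (∀ j, ∀ t ∈ U, ∃ G : ℂ × ℂ → ℂ, AnalyticAt ℂ G (t, ε₀) ∧
        (∀ᶠ q in 𝓝 (t, ε₀), ∑ l, C j l q.2 * g l q = (q.2 - ε₀) ^ m * G q) ∧
        ∀ᶠ s in 𝓝 t, z j s = G (s, ε₀)) ∧
      LinearIndependent ℂ fun j => fun t : U => z j t := by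
  classical
  let D : (Fin n → U) → ℂ → ℂ := fun τ ε => (Matrix.of fun i j => g i (τ j, ε)).det
  have hentry : ∀ (τ : Fin n → U) (ε : ℂ), ε ∈ V → ∀ i j, AnalyticAt ℂ
      (fun e => (Matrix.of fun i j => g i (τ j, e) : Matrix (Fin n) (Fin n) ℂ) i j) ε :=
    fun τ ε hε i j => analyticAt_snd_slice (hg i (τ j, ε) ⟨(τ j).2, hε⟩)
  have hD : ∀ τ, AnalyticOnNhd ℂ (D τ) V := fun τ ε hε => analyticAt_det (hentry τ ε hε)
  obtain ⟨τ₁, hτ₁⟩ := exists_det_ne_zero hli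
  have hτ₁top : analyticOrderAt (D τ₁) ε₀ ≠ ⊤ := fun h => hτ₁
    ((hD τ₁).eqOn_zero_of_preconnected_of_eventuallyEq_zero hVc hε₀ (analyticOrderAt_eq_top.1 h)
      hε₁)
  -- Take nodes minimizing the order of the determinant at `ε₀`, which is finite by the identity
  -- theorem on `V`.
  obtain ⟨_, ⟨τ, rfl⟩, hmin⟩ := (wellFounded_lt (α := ℕ∞)).has_min
    (Set.range fun τ => analyticOrderAt (D τ) ε₀) ⟨_, ⟨τ₁, rfl⟩⟩
  replace hmin : ∀ τ', analyticOrderAt (D τ) ε₀ ≤ analyticOrderAt (D τ') ε₀ := fun τ' =>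
    not_lt.1 (hmin _ ⟨τ', rfl⟩)
  have hτtop : analyticOrderAt (D τ) ε₀ ≠ ⊤ := ne_top_of_le_ne_top hτ₁top (hmin τ₁)
  set m := analyticOrderNatAt (D τ) ε₀
  have hm : analyticOrderAt (D τ) ε₀ = m := (Nat.cast_analyticOrderNatAt hτtop).symm
  let C : Fin n → Fin n → ℂ → ℂ := fun j l ε =>
    (Matrix.of fun i j => g i (τ j, ε) : Matrix (Fin n) (Fin n) ℂ).adjugate j l
  let N : Fin n → ℂ × ℂ → ℂ := fun j q => ∑ l, C j l q.2 * g l q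
  -- By Cramer's rule `N j` is the determinant with its `j`-th node moved to `t`; minimality then
  -- makes it divisible by `(ε - ε₀) ^ m`.
  have hN : ∀ j, ∀ t (ht : t ∈ U) (ε : ℂ),
      N j (t, ε) = D (Function.update τ j ⟨t, ht⟩) ε := by
    intro j t ht ε
    have h1 : N j (t, ε) = (Matrix.of fun i j => g i (τ j, ε) : Matrix (Fin n) (Fin n) ℂ).cramer
        (fun l => g l (t, ε)) j := by
      rw [Matrix.cramer_eq_adjugate_mulVec]; rfl
    rw [h1, Matrix.cramer_apply]
    congr 1
    ext i j'
    by_cases h : j' = j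
    · subst h; simp
    · simp [Matrix.updateCol_ne h, Function.update_of_ne h]
  have hNan : ∀ j, ∀ t ∈ U, AnalyticAt ℂ (N j) (t, ε₀) := fun j t ht =>
    Finset.analyticAt_fun_sum _ fun l _ => AnalyticAt.fun_mul
      ((analyticAt_adjugate (hentry τ ε₀ hε₀) j l).fun_comp (f := Prod.snd) (x := (t, ε₀))
        analyticAt_snd) (hg l (t, ε₀) ⟨ht, hε₀⟩)
  have hdvd : ∀ j, ∀ t ∈ U, PowDvdAt ε₀ m (N j) (t, ε₀) := by
    intro j t ht
    refine powDvdAt_of_analyticOrderAt (p := (t, ε₀)) (hNan j t ht) ?_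
    filter_upwards [hU.mem_nhds ht] with s hs
    rw [← hm, funext (hN j s hs)]
    exact hmin _
  -- The quotients exist only locally in `t`; the limit glues their values at `ε₀`.
  let z : Fin n → ℂ → ℂ := fun j t =>
    limUnder (𝓝[≠] ε₀) fun ε => N j (t, ε) / (ε - ε₀) ^ m
  have hz : ∀ {j t} {G : ℂ → ℂ}, ContinuousAt G ε₀ →
      (∀ᶠ ε in 𝓝 ε₀, N j (t, ε) = (ε - ε₀) ^ m * G ε) → z j t = G ε₀ := by
    intro j t G hG h
    refine Tendsto.limUnder_eq ((hG.mono_left nhdsWithin_le_nhds).congr' ?_)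
    filter_upwards [h.filter_mono nhdsWithin_le_nhds, self_mem_nhdsWithin] with ε h1 h2
    rw [h1, mul_div_cancel_left₀ _ (pow_ne_zero _ (sub_ne_zero.2 h2))]
  refine ⟨m, C, z, fun j t ht => ?_, ?_⟩
  · obtain ⟨G, hG, hNG⟩ := hdvd j t ht
    refine ⟨G, hG, hNG, ?_⟩
    filter_upwards [(tendsto_fst_slice (t, ε₀)).eventually hNG.eventually_nhds,
      (tendsto_fst_slice (t, ε₀)).eventually hG.eventually_analyticAt] with s h1 h2
    exact hz (G := fun e => G (s, e)) (analyticAt_snd_slice h2).continuousAt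
      ((tendsto_snd_slice (s, ε₀)).eventually h1)
  -- At the nodes the `z j` form the nonzero scalar matrix `D₁ ε₀`: off the diagonal two columns
  -- coincide.
  · obtain ⟨D₁, hD₁, hD₁0, hDe⟩ := ((hD τ ε₀ hε₀).analyticOrderAt_eq_natCast).1 hm
    have hdiag : ∀ j, z j (τ j) = D₁ ε₀ := fun j => hz hD₁.continuousAt (by
      filter_upwards [hDe] with ε h1
      rw [hN j (τ j) (τ j).2]
      simpa using h1)
    have hoff : ∀ i j, i ≠ j → z j (τ i) = 0 := fun i j hij =>
      hz (G := fun _ => 0) continuousAt_const (Eventually.of_forall fun ε => by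
        rw [hN j (τ i) (τ i).2, mul_zero]
        refine Matrix.det_zero_of_column_eq hij fun k => ?_
        simp [Function.update_of_ne hij])
    rw [Fintype.linearIndependent_iff]
    intro c hc i
    have h1 := congrFun hc (τ i)
    rw [Finset.sum_apply, Finset.sum_eq_single i] at h1
    · simp only [Pi.smul_apply, smul_eq_mul, hdiag, Pi.zero_apply] at h1
      exact (mul_eq_zero.1 h1).resolve_right hD₁0
    · intro j _ hj
      simp [hoff i j hj.symm]
    · simp

end SingularODE

/-! ### The contradiction on the line `ε = ε₀` -/

open SingularODE

theorem theorem1 {n l : ℕ} (c d : ℂ) (r s : ℝ) (U V : Set ℂ)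
    (hU : U = Metric.ball c r) (hV : V = Metric.ball d s)
    (a : Fin (n + 1) → ℂ × ℂ → ℂ)
    (ha : SingularODE.IsMeromorphicODE U V a)
    (hsing : ∃ ε₀ ∈ V, SingularODE.ODESingularlyPerturbedAt U a ε₀)
    (y : Fin l → ℂ × ℂ → ℂ)
    (hy : ∀ i, SingularODE.IsHolomorphicSolution U V a (y i)) :
    ∀ ε ∈ V,
      Module.finrank ℂ
        (Submodule.span ℂ (Set.range fun i : Fin l => fun t : U => y i ((t : ℂ), ε))) + 1 ≤ n := by
  intro ε₁ hε₁
  obtain ⟨ε₀, hε₀, k₀, t₀, ht₀, u, v, huv, m₀, hv, hu⟩ := hsing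
  have hUo : IsOpen U := hU ▸ Metric.isOpen_ball
  have hVo : IsOpen V := hV ▸ Metric.isOpen_ball
  have hUc : IsPreconnected U := hU ▸ (convex_ball c r).isPreconnected
  have hVc : IsPreconnected V := hV ▸ (convex_ball d s).isPreconnected
  by_contra! hlt
  have := Module.Finite.span_of_finite ℂ
    (Set.finite_range fun i : Fin l => fun t : U => y i ((t : ℂ), ε₁))
  obtain ⟨f, hf, -, hfli⟩ := Submodule.exists_fun_fin_finrank_span_eq ℂ
    (Set.range fun i : Fin l => fun t : U => y i ((t : ℂ), ε₁))
  choose σ hσ using hf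
  have hn := Nat.le_of_lt_succ hlt
  let g : Fin n → ℂ × ℂ → ℂ := fun i => y (σ (Fin.castLE hn i))
  have hg : ∀ i, IsHolomorphicSolution U V a (g i) := fun i => hy _
  have hgli : LinearIndependent ℂ fun i => fun t : U => g i (t, ε₁) := by
    have : (fun i => fun t : U => g i (t, ε₁)) = f ∘ Fin.castLE hn := funext fun i => hσ _
    rw [this]
    exact hfli.comp _ (Fin.castLE_injective hn)
  obtain ⟨b, hb, hne, hlast, hbeq⟩ := exists_reduced_equation hUo hVo ha.1
    (p := (t₀, ε₀)) ⟨ht₀, hε₀⟩ huv hv hu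
  obtain ⟨m, C, z, hz, hzli⟩ := exists_saturation hUo hVc (fun i => (hg i).1) hε₀ hε₁ hgli
  have hzan : ∀ j, AnalyticOnNhd ℂ (z j) U := fun j t ht => by
    obtain ⟨G, hG, -, hzG⟩ := hz j t ht
    exact (analyticAt_fst_slice hG).congr (hzG.mono fun _ h => h.symm)
  have heq : ∀ j, ∀ᶠ t in 𝓝 t₀, ∑ k, b k (t, ε₀) * iteratedDeriv (k : ℕ) (z j) t = 0 := by
    intro j
    obtain ⟨G, hG, hNG, hzG⟩ := hz j t₀ ht₀
    -- `(ε - ε₀) ^ m * G` combines solutions with coefficients free of `t`; the power is then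
    -- cancelled.
    have h1 : ∀ᶠ q in 𝓝 (t₀, ε₀), ∑ k, b k q * fstDeriv (k : ℕ) G q = 0 := by
      refine eventually_eq_zero_of_sub_pow_mul (m := m) (Finset.analyticAt_fun_sum _ fun k _ =>
        (hb k).fun_mul (analyticAt_fstDeriv hG k)) ?_
      filter_upwards [eventually_all.2 fun i => hbeq _ (hg i),
        eventually_all.2 fun i => ((hg i).1 (t₀, ε₀) ⟨ht₀, hε₀⟩).eventually_analyticAt,
        eventually_all.2 fun k : Fin (n + 1) => fstDeriv_congr hNG (k : ℕ)] with q h2 h3 h4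
      have h5 : ∀ k : Fin (n + 1), (q.2 - ε₀) ^ m * fstDeriv (k : ℕ) G q =
          ∑ i, C j i q.2 * fstDeriv (k : ℕ) (g i) q := fun k => by
        rw [← fstDeriv_sum_snd_mul (C j) k h3, h4 k]
        exact (fstDeriv_snd_mul (fun e => (e - ε₀) ^ m) G k q).symm
      calc (q.2 - ε₀) ^ m * ∑ k, b k q * fstDeriv (k : ℕ) G q
          = ∑ k, b k q * ∑ i, C j i q.2 * fstDeriv (k : ℕ) (g i) q := by
            rw [Finset.mul_sum]
            exact Finset.sum_congr rfl fun k _ => by rw [← h5 k]; ring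
        _ = ∑ i, C j i q.2 * ∑ k, b k q * fstDeriv (k : ℕ) (g i) q := by
            simp only [Finset.mul_sum]
            rw [Finset.sum_comm]
            exact Finset.sum_congr rfl fun i _ => Finset.sum_congr rfl fun k _ => by ring
        _ = 0 := by simp [h2]
    filter_upwards [(tendsto_fst_slice (t₀, ε₀)).eventually h1, hzG.eventually_nhds] with t h2 h3
    rw [← h2]
    exact Finset.sum_congr rfl fun k _ => by rw [EventuallyEq.iteratedDeriv_eq k h3]; rfl
  obtain ⟨q, ⟨e, he, hzero⟩, hq⟩ := ((exists_linear_relation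
    (fun k => analyticAt_fst_slice (hb k)) (fun j => hzan j t₀ ht₀) hlast hne heq).and_eventually
    (hUo.mem_nhds ht₀)).exists
  -- The relation near `q` spreads over the connected `U`.
  have hall := AnalyticOnNhd.eqOn_zero_of_preconnected_of_eventuallyEq_zero
    (f := fun t => ∑ j, e j * z j t) (fun t ht => Finset.analyticAt_fun_sum _ fun j _ =>
      analyticAt_const.fun_mul (hzan j t ht)) hUc hq hzero
  refine he (funext fun i => Fintype.linearIndependent_iff.1 hzli e (funext fun t => ?_) i)
  simpa using hall t.2
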